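/- Let $R$ be an associative unital ring, not necessarily commutative, and let $n>1$ be an integer. A module $X$ is finitely $n$-presented if there is an exact sequence $F_n\to F_{n-1}\to\cdots\to F_0\to X\to 0$ with every $F_i$ finitely generated projective. A left $R$-module $M$ is $FP_n$-flat if $\operatorname{Tor}^R_1(X,M)=0$ for every finitely $n$-presented right $R$-module $X$. The ring $R$ is right $n$-hereditary if every finitely $(n-1)$-presented submodule of a finitely generated projective right $R$-module is projective. An $FP_n$-flat envelope of a left $R$-module $M$ is a homomorphism $\varphi\colon M\to E$ with $E$ $FP_n$-flat such that every homomorphism from $M$ to an $FP_n$-flat left module factors through $\varphi$, and every endomorphism $g$ of $E$ with $g\varphi=\varphi$ is an automorphism; it is epimorphic if $\varphi$ is surjective. Then the following are equivalent: 1. every left $R$-module has an epimorphic $FP_n$-flat envelope; 2. $R$ is right $n$-hereditary; 3. every submodule of an $FP_n$-flat left $R$-module is $FP_n$-flat; 4. the class of $FP_n$-flat left $R$-modules is a pretorsion-free class, that is, it is closed under submodules and direct products. -/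

import Mathlib

open CategoryTheory Limits
open scoped TensorProduct MulOpposite

universe u

/-!
Rings are associative and unital, not necessarily commutative. Left `R`-modules are objects of
`ModuleCat R`, right `R`-modules are modules over the opposite ring `Rᵐᵒᵖ`; the right action
`x · r` is written `MulOpposite.op r • x`.
-/

section FinitelyPresented

variable (S : Type u) [Ring S]

/-- A (left) `S`-module `M` is finitely `n`-presented if there is an exact sequence
`F n → F (n-1) → ⋯ → F 1 → F 0 → M → 0` in which every `F i`, `i ≤ n`, is a finitely generated
projective module. (The values of `F` and `d` beyond the displayed sequence are irrelevant.) -/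
def IsFinitelyNPresented (n : ℕ) (M : Type u) [AddCommGroup M] [Module S M] : Prop :=
  ∃ (F : ℕ → ModuleCat.{u} S) (d : ∀ i, F (i + 1) →ₗ[S] F i) (ε : F 0 →ₗ[S] M),
    (∀ i, i ≤ n → Module.Finite S (F i) ∧ Module.Projective S (F i)) ∧
    Function.Surjective ε ∧
    (1 ≤ n → Function.Exact (d 0) ε) ∧
    ∀ i, i + 2 ≤ n → Function.Exact (d (i + 1)) (d i)

/-- A ring is left `n`-hereditary (`n ≥ 1`) if every finitely `(n-1)`-presented submodule of a
finitely generated projective left module is projective. -/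
def IsLeftNHereditary (n : ℕ) : Prop :=
  ∀ (P : Type u) [AddCommGroup P] [Module S P], Module.Finite S P → Module.Projective S P →
    ∀ K : Submodule S P, IsFinitelyNPresented S (n - 1) K → Module.Projective S K

/-- A ring is right `n`-hereditary if its opposite ring is left `n`-hereditary, that is, if every
finitely `(n-1)`-presented submodule of a finitely generated projective right module is
projective. -/
def IsRightNHereditary (n : ℕ) : Prop :=
  IsLeftNHereditary Sᵐᵒᵖ n

end FinitelyPresented

section Tensor

variable (R : Type u) [Ring R]

/-- The subgroup of `X ⊗[ℤ] M` generated by the elements `(x · r) ⊗ m - x ⊗ (r • m)`. -/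
def balancedRelations (X : Type u) [AddCommGroup X] [Module Rᵐᵒᵖ X]
    (M : Type u) [AddCommGroup M] [Module R M] : AddSubgroup (X ⊗[ℤ] M) :=
  AddSubgroup.closure
    {t | ∃ (x : X) (r : R) (m : M), t = (MulOpposite.op r • x) ⊗ₜ[ℤ] m - x ⊗ₜ[ℤ] (r • m)}

/-- The tensor product `X ⊗_R M` of a right `R`-module `X` and a left `R`-module `M` over a
not necessarily commutative ring, an abelian group. -/
abbrev BalancedTensor (X : Type u) [AddCommGroup X] [Module Rᵐᵒᵖ X]
    (M : Type u) [AddCommGroup M] [Module R M] : Type u :=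
  (X ⊗[ℤ] M) ⧸ balancedRelations R X M

variable {R}

/-- The map `f ⊗_R M : X ⊗_R M → Y ⊗_R M`, `x ⊗ m ↦ f x ⊗ m`, induced by a map `f : X → Y` of
right modules. -/
def BalancedTensor.map {X Y : Type u} [AddCommGroup X] [Module Rᵐᵒᵖ X] [AddCommGroup Y]
    [Module Rᵐᵒᵖ Y] (M : Type u) [AddCommGroup M] [Module R M] (f : X →ₗ[Rᵐᵒᵖ] Y) :
    BalancedTensor R X M →+ BalancedTensor R Y M :=
  QuotientAddGroup.map _ _
    (LinearMap.rTensor M f.toAddMonoidHom.toIntLinearMap).toAddMonoidHom (by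
    refine (AddSubgroup.closure_le _).2 ?_
    rintro _ ⟨x, r, m, rfl⟩
    refine AddSubgroup.subset_closure ⟨f x, r, m, ?_⟩
    rw [map_sub, ← f.map_smul]
    rfl)

/-- Additive maps out of `X ⊗_R M` that agree on the elements `x ⊗ m` are equal. -/
theorem BalancedTensor.hom_ext {X M A : Type u} [AddCommGroup X] [Module Rᵐᵒᵖ X]
    [AddCommGroup M] [Module R M] [AddCommGroup A] {f g : BalancedTensor R X M →+ A}
    (h : ∀ (x : X) (m : M), f (QuotientAddGroup.mk (x ⊗ₜ[ℤ] m)) =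
      g (QuotientAddGroup.mk (x ⊗ₜ[ℤ] m))) : f = g := by
  ext t
  induction t using TensorProduct.induction_on with
  | zero => rw [map_zero, map_zero]
  | tmul x m => exact h x m
  | add a b ha hb => rw [map_add, map_add, ha, hb]

/-- The functor `- ⊗_R M` from right `R`-modules to abelian groups. -/
def tensorFunctor (M : ModuleCat.{u} R) : ModuleCat.{u} Rᵐᵒᵖ ⥤ AddCommGrpCat.{u} where
  obj X := AddCommGrpCat.of (BalancedTensor R X M)
  map f := AddCommGrpCat.ofHom (BalancedTensor.map M f.hom)
  map_id _ := AddCommGrpCat.hom_ext (BalancedTensor.hom_ext fun _ _ => rfl)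
  map_comp _ _ := AddCommGrpCat.hom_ext (BalancedTensor.hom_ext fun _ _ => rfl)

instance tensorFunctor_additive (M : ModuleCat.{u} R) : (tensorFunctor M).Additive where
  map_add {_ Y f g} := AddCommGrpCat.hom_ext (BalancedTensor.hom_ext fun x m =>
    congrArg (QuotientAddGroup.mk (s := balancedRelations R Y M))
      (TensorProduct.add_tmul (f.hom x) (g.hom x) m))

/-- `Tor_i^R(X, M)` as a functor of the right `R`-module `X`: the `i`-th left derived functor of
`- ⊗_R M`. -/
noncomputable def torFunctor (i : ℕ) (M : ModuleCat.{u} R) :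
    ModuleCat.{u} Rᵐᵒᵖ ⥤ AddCommGrpCat.{u} :=
  (tensorFunctor M).leftDerived i

/-- A left `R`-module `M` is `FP_n`-flat if `Tor_1^R(X, M) = 0` for every finitely `n`-presented
right `R`-module `X`. -/
def IsFPFlat (n : ℕ) (M : ModuleCat.{u} R) : Prop :=
  ∀ X : ModuleCat.{u} Rᵐᵒᵖ, IsFinitelyNPresented Rᵐᵒᵖ n X → IsZero ((torFunctor 1 M).obj X)

end Tensor

section Classes

variable {R : Type u} [Ring R]

/-- A map `φ : M → E` is a `C`-preenvelope of `M` if `E` lies in the class `C` and every map from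
`M` to a module in `C` factors through `φ`. -/
def IsPreenvelope (C : ModuleCat.{u} R → Prop) {M E : ModuleCat.{u} R} (φ : M →ₗ[R] E) : Prop :=
  C E ∧ ∀ E' : ModuleCat.{u} R, C E' → ∀ f : M →ₗ[R] E', ∃ g : E →ₗ[R] E', g ∘ₗ φ = f

/-- A `C`-envelope is a `C`-preenvelope `φ : M → E` such that every endomorphism `g` of `E` with
`g ∘ φ = φ` is an automorphism. -/
def IsEnvelope (C : ModuleCat.{u} R → Prop) {M E : ModuleCat.{u} R} (φ : M →ₗ[R] E) : Prop :=
  IsPreenvelope C φ ∧ ∀ g : E →ₗ[R] E, g ∘ₗ φ = φ → Function.Bijective g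

/-- `M` has an epimorphic `C`-envelope: a `C`-envelope that is surjective. -/
def HasEpimorphicEnvelope (C : ModuleCat.{u} R → Prop) (M : ModuleCat.{u} R) : Prop :=
  ∃ (E : ModuleCat.{u} R) (φ : M →ₗ[R] E), IsEnvelope C φ ∧ Function.Surjective φ

/-- The class `C` is closed under submodules. -/
def IsClosedUnderSubmodules (C : ModuleCat.{u} R → Prop) : Prop :=
  ∀ M : ModuleCat.{u} R, C M → ∀ N : Submodule R M, C (ModuleCat.of R N)

/-- The class `C` is closed under (set-indexed) direct products. -/
def IsClosedUnderDirectProducts (C : ModuleCat.{u} R → Prop) : Prop :=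
  ∀ (ι : Type u) (M : ι → ModuleCat.{u} R), (∀ i, C (M i)) → C (ModuleCat.of R (∀ i, M i))

/-- A pretorsion-free class: a class of modules closed under submodules and direct products. -/
def IsPretorsionFreeClass (C : ModuleCat.{u} R → Prop) : Prop :=
  IsClosedUnderSubmodules C ∧ IsClosedUnderDirectProducts C

end Classes

/-! Write a finitely `n`-presented right module as `P/K`, with `P` finitely generated projective and
`K` finitely `(n-1)`-presented. Then `Tor₁(P/K, M) = 0` says that `K ⊗ M → P ⊗ M` is injective, so
`FP_n`-flatness is a condition on such pairs `K ⊆ P` (`isFPFlat_succ_iff`). Since `n > 1`, every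
such `K` is finitely presented.

For a submodule `N ⊆ M`, compare `K ⊗ N → K ⊗ M → P ⊗ M` with `K ⊗ N → P ⊗ N → P ⊗ M`; the map `P ⊗
N → P ⊗ M` is always injective. If `K` is projective, injectivity passes from `M` to `N`.
Conversely, if submodules of the `FP_n`-flat modules `Rᵐ` are `FP_n`-flat, then `K ⊗ N → K ⊗ Rᵐ` is
injective for all `N ⊆ Rᵐ`, and a finitely presented module with this property is projective. This
gives 2 ⇔ 3.

Products come for free, since `K ⊗ ∏ Mᵢ → ∏ (K ⊗ Mᵢ)` is injective for finitely presented `K`.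
Envelopes are then a formal matter of submodules and products. -/

section TensorCalculus

variable {R : Type u} [Ring R]

/-! ### Tensor products over a noncommutative ring -/

namespace BalancedTensor

variable {X Y Z : Type u} [AddCommGroup X] [Module Rᵐᵒᵖ X] [AddCommGroup Y] [Module Rᵐᵒᵖ Y]
  [AddCommGroup Z] [Module Rᵐᵒᵖ Z]
  {M N L : Type u} [AddCommGroup M] [Module R M] [AddCommGroup N] [Module R N]
  [AddCommGroup L] [Module R L] {A : Type*} [AddCommGroup A]

/-- The class of `x ⊗ m` in `X ⊗_R M`. -/
def tmul (x : X) (m : M) : BalancedTensor R X M :=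
  QuotientAddGroup.mk (x ⊗ₜ[ℤ] m)

theorem add_tmul (x y : X) (m : M) :
    (tmul (x + y) m : BalancedTensor R X M) = tmul x m + tmul y m :=
  congrArg (QuotientAddGroup.mk (s := balancedRelations R X M)) (TensorProduct.add_tmul x y m)

theorem tmul_add (x : X) (m n : M) :
    (tmul x (m + n) : BalancedTensor R X M) = tmul x m + tmul x n :=
  congrArg (QuotientAddGroup.mk (s := balancedRelations R X M)) (TensorProduct.tmul_add x m n)

/-- The biadditive map `(x, m) ↦ x ⊗ m`. -/
def tmulHom (X : Type u) [AddCommGroup X] [Module Rᵐᵒᵖ X] (M : Type u) [AddCommGroup M]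
    [Module R M] : X →+ M →+ BalancedTensor R X M :=
  AddMonoidHom.mk' (fun x => AddMonoidHom.mk' (tmul x) (tmul_add x))
    fun x y => AddMonoidHom.ext (add_tmul x y)

@[simp] theorem tmulHom_apply (x : X) (m : M) : tmulHom (R := R) X M x m = tmul x m := rfl

theorem sum_tmul {ι : Type*} (s : Finset ι) (x : ι → X) (m : M) :
    (tmul (∑ i ∈ s, x i) m : BalancedTensor R X M) = ∑ i ∈ s, tmul (x i) m := by
  simp only [← tmulHom_apply, map_sum, AddMonoidHom.finsetSum_apply]

theorem tmul_sum {ι : Type*} (s : Finset ι) (x : X) (m : ι → M) :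
    (tmul x (∑ i ∈ s, m i) : BalancedTensor R X M) = ∑ i ∈ s, tmul x (m i) := by
  simp only [← tmulHom_apply, map_sum]

theorem zero_tmul (m : M) : (tmul (0 : X) m : BalancedTensor R X M) = 0 := by
  simp only [← tmulHom_apply, map_zero, AddMonoidHom.zero_apply]

theorem smul_tmul (r : R) (x : X) (m : M) :
    (tmul (MulOpposite.op r • x) m : BalancedTensor R X M) = tmul x (r • m) :=
  QuotientAddGroup.eq_iff_sub_mem.2 (AddSubgroup.subset_closure ⟨x, r, m, rfl⟩)

theorem induction_on {p : BalancedTensor R X M → Prop} (t : BalancedTensor R X M)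
    (zero : p 0) (tmul : ∀ x m, p (tmul x m)) (add : ∀ s t, p s → p t → p (s + t)) : p t := by
  obtain ⟨t, rfl⟩ := QuotientAddGroup.mk_surjective t
  induction t using TensorProduct.induction_on with
  | zero => exact zero
  | tmul x m => exact tmul x m
  | add a b ha hb => exact add _ _ ha hb

theorem exists_sum_tmul (t : BalancedTensor R X M) :
    ∃ (k : ℕ) (x : Fin k → X) (m : Fin k → M), t = ∑ i, tmul (x i) (m i) := by
  induction t using induction_on with
  | zero => exact ⟨0, Fin.elim0, Fin.elim0, by simp⟩
  | tmul x m => exact ⟨1, fun _ => x, fun _ => m, by simp⟩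
  | add s t hs ht =>
    obtain ⟨k, x, m, rfl⟩ := hs
    obtain ⟨l, y, n, rfl⟩ := ht
    exact ⟨k + l, Fin.append x y, Fin.append m n, by simp [Fin.sum_univ_add]⟩

/-- The additive map out of `X ⊗_R M` given by a balanced biadditive map. -/
def lift (f : X →+ M →+ A) (hf : ∀ x (r : R) m, f (MulOpposite.op r • x) m = f x (r • m)) :
    BalancedTensor R X M →+ A :=
  QuotientAddGroup.lift _ (TensorProduct.liftAddHom f fun r x m => by simp) (by
    refine (AddSubgroup.closure_le _).2 ?_
    rintro _ ⟨x, r, m, rfl⟩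
    change TensorProduct.liftAddHom f _ _ = 0
    rw [map_sub, TensorProduct.liftAddHom_tmul, TensorProduct.liftAddHom_tmul, hf, sub_self])

@[simp] theorem map_tmul (f : X →ₗ[Rᵐᵒᵖ] Y) (x : X) (m : M) :
    map M f (tmul x m) = tmul (f x) m := rfl

/-- The map `X ⊗_R g : X ⊗_R M → X ⊗_R N` induced by a map `g : M → N` of left modules. -/
def mapRight (X : Type u) [AddCommGroup X] [Module Rᵐᵒᵖ X] (g : M →ₗ[R] N) :
    BalancedTensor R X M →+ BalancedTensor R X N :=
  lift ((AddMonoidHom.compHom.flip g.toAddMonoidHom).comp (tmulHom X N)) fun x r m => by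
    simp [AddMonoidHom.flip_apply, smul_tmul]

@[simp] theorem mapRight_tmul (g : M →ₗ[R] N) (x : X) (m : M) :
    mapRight X g (tmul x m) = tmul x (g m) := rfl

theorem map_map (f : X →ₗ[Rᵐᵒᵖ] Y) (g : Y →ₗ[Rᵐᵒᵖ] Z) (t : BalancedTensor R X M) :
    map M g (map M f t) = map M (g ∘ₗ f) t :=
  DFunLike.congr_fun (hom_ext (f := (map M g).comp (map M f)) (g := map M (g ∘ₗ f))
    fun _ _ => rfl) t

theorem map_id (t : BalancedTensor R X M) : map M (LinearMap.id : X →ₗ[Rᵐᵒᵖ] X) t = t :=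
  DFunLike.congr_fun (hom_ext (f := map M LinearMap.id) (g := AddMonoidHom.id _)
    fun _ _ => rfl) t

theorem map_sub_apply (f g : X →ₗ[Rᵐᵒᵖ] Y) (t : BalancedTensor R X M) :
    map M (f - g) t = map M f t - map M g t :=
  DFunLike.congr_fun (hom_ext (f := map M (f - g)) (g := map M f - map M g)
    fun x m => congrArg (QuotientAddGroup.mk (s := balancedRelations R Y M))
      (TensorProduct.sub_tmul (f x) (g x) m)) t

theorem mapRight_mapRight (f : M →ₗ[R] N) (g : N →ₗ[R] L) (t : BalancedTensor R X M) :
    mapRight X g (mapRight X f t) = mapRight X (g ∘ₗ f) t :=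
  DFunLike.congr_fun (hom_ext (f := (mapRight X g).comp (mapRight X f))
    (g := mapRight X (g ∘ₗ f)) fun _ _ => rfl) t

theorem mapRight_id (t : BalancedTensor R X M) : mapRight X (LinearMap.id : M →ₗ[R] M) t = t :=
  DFunLike.congr_fun (hom_ext (f := mapRight X LinearMap.id) (g := AddMonoidHom.id _)
    fun _ _ => rfl) t

theorem map_mapRight (f : X →ₗ[Rᵐᵒᵖ] Y) (g : M →ₗ[R] N) (t : BalancedTensor R X M) :
    map N f (mapRight X g t) = mapRight Y g (map M f t) :=
  DFunLike.congr_fun (hom_ext (f := (map N f).comp (mapRight X g))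
    (g := (mapRight Y g).comp (map M f)) fun _ _ => rfl) t

theorem map_surjective {f : X →ₗ[Rᵐᵒᵖ] Y} (hf : Function.Surjective f) :
    Function.Surjective (map M f) := fun t => by
  induction t using induction_on with
  | zero => exact ⟨0, _root_.map_zero _⟩
  | tmul x m => obtain ⟨y, rfl⟩ := hf x; exact ⟨tmul y m, rfl⟩
  | add s t hs ht =>
    obtain ⟨s, rfl⟩ := hs
    obtain ⟨t, rfl⟩ := ht
    exact ⟨s + t, map_add _ _ _⟩

/-- Right exactness of `- ⊗_R M`. -/
theorem map_exact {f : X →ₗ[Rᵐᵒᵖ] Y} {g : Y →ₗ[Rᵐᵒᵖ] Z} (hfg : Function.Exact f g)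
    (hg : Function.Surjective g) : Function.Exact (map M f) (map M g) := by
  refine fun t => ⟨fun ht => ?_, ?_⟩
  · obtain ⟨t, rfl⟩ := QuotientAddGroup.mk_surjective t
    have hmem : LinearMap.rTensor M g.toAddMonoidHom.toIntLinearMap t ∈
        balancedRelations R Z M := (QuotientAddGroup.eq_zero_iff _).1 ht
    -- Balancing relations lift along the surjection `g`. Subtracting a lifted relation from `t`
    -- reduces the claim to right exactness over `ℤ`.
    have hle : balancedRelations R Z M ≤ (balancedRelations R Y M).map
        (LinearMap.rTensor M g.toAddMonoidHom.toIntLinearMap).toAddMonoidHom := by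
      refine (AddSubgroup.closure_le _).2 ?_
      rintro _ ⟨z, r, m, rfl⟩
      obtain ⟨y, rfl⟩ := hg z
      refine ⟨_, AddSubgroup.subset_closure ⟨y, r, m, rfl⟩, ?_⟩
      rw [map_sub, ← g.map_smul]
      rfl
    obtain ⟨b, hb, hbt⟩ := hle hmem
    have hex : Function.Exact f.toAddMonoidHom.toIntLinearMap g.toAddMonoidHom.toIntLinearMap := hfg
    obtain ⟨s, hs⟩ := (rTensor_exact M hex hg (t - b)).1 (by
      rw [map_sub]; exact sub_eq_zero.2 hbt.symm)
    refine ⟨QuotientAddGroup.mk s, ?_⟩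
    refine QuotientAddGroup.eq_iff_sub_mem.2 ?_
    change LinearMap.rTensor M f.toAddMonoidHom.toIntLinearMap s - t ∈ _
    rw [hs, sub_sub_cancel_left]
    exact neg_mem hb
  · rintro ⟨s, rfl⟩
    rw [map_map, LinearMap.ext hfg.apply_apply_eq_zero (f := g ∘ₗ f) (g := 0)]
    induction s using induction_on with
    | zero => exact _root_.map_zero _
    | tmul x m => exact zero_tmul m
    | add s t hs ht => rw [map_add, hs, ht, add_zero]

/-- Right exactness of `X ⊗_R -`. -/
theorem exists_mapRight_eq_of_mapRight_eq_zero {f : L →ₗ[R] M} {g : M →ₗ[R] N}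
    (hfg : Function.Exact f g) (hg : Function.Surjective g) {t : BalancedTensor R X M}
    (ht : mapRight X g t = 0) : ∃ s, mapRight X f s = t := by
  obtain ⟨t, rfl⟩ := QuotientAddGroup.mk_surjective t
  have hmk (t : X ⊗[ℤ] M) : mapRight X g (QuotientAddGroup.mk t) =
      QuotientAddGroup.mk (LinearMap.lTensor X g.toAddMonoidHom.toIntLinearMap t) := by
    induction t using TensorProduct.induction_on with
    | zero => rfl
    | tmul x m => rfl
    | add a b ha hb =>
      rw [map_add, QuotientAddGroup.mk_add, map_add, ha, hb]; rfl
  have hmk' (t : X ⊗[ℤ] L) : mapRight X f (QuotientAddGroup.mk t) =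
      QuotientAddGroup.mk (LinearMap.lTensor X f.toAddMonoidHom.toIntLinearMap t) := by
    induction t using TensorProduct.induction_on with
    | zero => rfl
    | tmul x m => rfl
    | add a b ha hb =>
      rw [map_add, QuotientAddGroup.mk_add, map_add, ha, hb]; rfl
  have hmem : LinearMap.lTensor X g.toAddMonoidHom.toIntLinearMap t ∈
      balancedRelations R X N := (QuotientAddGroup.eq_zero_iff _).1 ((hmk t).symm.trans ht)
  have hle : balancedRelations R X N ≤ (balancedRelations R X M).map
      (LinearMap.lTensor X g.toAddMonoidHom.toIntLinearMap).toAddMonoidHom := by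
    refine (AddSubgroup.closure_le _).2 ?_
    rintro _ ⟨x, r, m, rfl⟩
    obtain ⟨y, rfl⟩ := hg m
    refine ⟨_, AddSubgroup.subset_closure ⟨x, r, y, rfl⟩, ?_⟩
    rw [map_sub, ← g.map_smul]
    rfl
  obtain ⟨b, hb, hbt⟩ := hle hmem
  have hex : Function.Exact f.toAddMonoidHom.toIntLinearMap g.toAddMonoidHom.toIntLinearMap := hfg
  obtain ⟨s, hs⟩ := (lTensor_exact X hex hg (t - b)).1 (by
    rw [map_sub]; exact sub_eq_zero.2 hbt.symm)
  refine ⟨QuotientAddGroup.mk s, ?_⟩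
  rw [hmk', hs]
  refine QuotientAddGroup.eq_iff_sub_mem.2 ?_
  rw [sub_sub_cancel_left]
  exact neg_mem hb

/-- The canonical map `Rᵏ ⊗_R M → Mᵏ`. -/
def freeLeft (ι : Type) (M : Type u) [AddCommGroup M] [Module R M] :
    BalancedTensor R (ι → Rᵐᵒᵖ) M →+ (ι → M) :=
  lift (AddMonoidHom.mk' (fun x => AddMonoidHom.mk' (fun m i => (x i).unop • m)
    fun _ _ => funext fun _ => smul_add _ _ _)
    fun x y => AddMonoidHom.ext fun m => funext fun i => add_smul (x i).unop (y i).unop m)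
    fun x r m => funext fun i => mul_smul (x i).unop r m

@[simp] theorem freeLeft_tmul {ι : Type} (x : ι → Rᵐᵒᵖ) (m : M) (i : ι) :
    freeLeft ι M (tmul x m) i = (x i).unop • m := rfl

/-- The canonical map `X ⊗_R Rᵏ → Xᵏ`. -/
def freeRight (X : Type u) (ι : Type) [AddCommGroup X] [Module Rᵐᵒᵖ X] :
    BalancedTensor R X (ι → R) →+ (ι → X) :=
  lift (AddMonoidHom.mk' (fun x => AddMonoidHom.mk' (fun m i => MulOpposite.op (m i) • x)
    fun m n => funext fun i => add_smul (MulOpposite.op (m i)) (MulOpposite.op (n i)) x)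
    fun _ _ => AddMonoidHom.ext fun _ => funext fun _ => smul_add _ _ _)
    fun x r m => funext fun i => (mul_smul (MulOpposite.op (m i)) (MulOpposite.op r) x).symm

@[simp] theorem freeRight_tmul {ι : Type} (x : X) (m : ι → R) (i : ι) :
    freeRight X ι (tmul x m) i = MulOpposite.op (m i) • x := rfl

section Free

variable {ι : Type} [Fintype ι] [DecidableEq ι]

theorem sum_tmul_freeLeft (t : BalancedTensor R (ι → Rᵐᵒᵖ) M) :
    ∑ i, tmul (Pi.single i 1) (freeLeft ι M t i) = t := by
  induction t using induction_on with
  | zero => simp [← tmulHom_apply]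
  | tmul x m =>
    simp only [freeLeft_tmul, ← smul_tmul, MulOpposite.op_unop, ← sum_tmul]
    congr 1
    ext i
    simp [Finset.sum_apply, Pi.single_apply]
  | add s t hs ht => simp only [map_add, Pi.add_apply, tmul_add, Finset.sum_add_distrib, hs, ht]

theorem freeLeft_sum_tmul (v : ι → M) :
    freeLeft ι M (∑ i, tmul (Pi.single i (1 : Rᵐᵒᵖ)) (v i)) = v := by
  ext j
  simp [Finset.sum_apply, Pi.single_apply, apply_ite, ite_smul]

theorem freeLeft_bijective : Function.Bijective (freeLeft (R := R) ι M) :=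
  ⟨fun s t h => by rw [← sum_tmul_freeLeft s, h, sum_tmul_freeLeft],
    fun v => ⟨_, freeLeft_sum_tmul v⟩⟩

theorem sum_freeRight_tmul (t : BalancedTensor R X (ι → R)) :
    ∑ i, tmul (freeRight X ι t i) (Pi.single i 1) = t := by
  induction t using induction_on with
  | zero => simp [← tmulHom_apply]
  | tmul x m =>
    simp only [freeRight_tmul, smul_tmul, ← tmul_sum]
    congr 1
    ext i
    simp [Finset.sum_apply, Pi.single_apply]
  | add s t hs ht => simp only [map_add, Pi.add_apply, add_tmul, Finset.sum_add_distrib, hs, ht]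

theorem freeRight_injective : Function.Injective (freeRight (R := R) X ι) :=
  fun s t h => by rw [← sum_freeRight_tmul s, h, sum_freeRight_tmul]

end Free

theorem freeLeft_mapRight {ι : Type} (g : M →ₗ[R] N) (t : BalancedTensor R (ι → Rᵐᵒᵖ) M)
    (i : ι) : freeLeft ι N (mapRight _ g t) i = g (freeLeft ι M t i) := by
  induction t using induction_on with
  | zero => simp
  | tmul x m => simp
  | add s t hs ht => simp [hs, ht]

theorem freeRight_map {ι : Type} (f : X →ₗ[Rᵐᵒᵖ] Y) (t : BalancedTensor R X (ι → R))
    (i : ι) : freeRight Y ι (map _ f t) i = f (freeRight X ι t i) := by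
  induction t using induction_on with
  | zero => simp
  | tmul x m => simp
  | add s t hs ht => simp [hs, ht]

end BalancedTensor

end TensorCalculus

/-! ### Dimension shifting for finite presentations -/

section FinitelyPresented

variable {S : Type u} [Ring S]

theorem IsFinitelyNPresented.finitePresentation {n : ℕ} {M : Type u} [AddCommGroup M] [Module S M]
    (h : IsFinitelyNPresented S (n + 1) M) : Module.FinitePresentation S M := by
  obtain ⟨F, d, ε, hF, hε, hd, -⟩ := h
  obtain ⟨_, _⟩ := hF 0 (Nat.zero_le _)
  obtain ⟨_, _⟩ := hF 1 (Nat.le_add_left _ _)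
  have := Module.finitePresentation_of_projective S (F 0)
  refine Module.finitePresentation_of_surjective ε hε ?_
  rw [(hd (Nat.le_add_left _ _)).linearMap_ker_eq, ← Submodule.map_top]
  exact Module.Finite.fg_top.map _

theorem IsFinitelyNPresented.exists_ker {n : ℕ} {M : Type u} [AddCommGroup M] [Module S M]
    (h : IsFinitelyNPresented S (n + 1) M) :
    ∃ (P : ModuleCat.{u} S) (ε : P →ₗ[S] M), Module.Finite S P ∧ Module.Projective S P ∧
      Function.Surjective ε ∧ IsFinitelyNPresented S n (LinearMap.ker ε) := by
  obtain ⟨F, d, ε, hF, hε, hd, hdd⟩ := h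
  have hex := hd (Nat.le_add_left _ _)
  refine ⟨F 0, ε, (hF 0 (Nat.zero_le _)).1, (hF 0 (Nat.zero_le _)).2, hε,
    fun i => F (i + 1), fun i => d (i + 1),
    (d 0).codRestrict _ fun x => hex.apply_apply_eq_zero x,
    fun i hi => hF _ (Nat.succ_le_succ hi), ?_, fun hn => ?_, fun i hi => hdd _ (by omega)⟩
  · rintro ⟨x, hx⟩
    obtain ⟨y, rfl⟩ := (hex x).1 hx
    exact ⟨y, rfl⟩
  · intro x
    rw [← hdd 0 (by omega) x, ← Submodule.coe_eq_zero]
    rfl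

theorem IsFinitelyNPresented.quotient {n : ℕ} {P : Type u} [AddCommGroup P] [Module S P]
    [Module.Finite S P] [Module.Projective S P] {K : Submodule S P}
    (h : IsFinitelyNPresented S n K) : IsFinitelyNPresented S (n + 1) (P ⧸ K) := by
  obtain ⟨F, d, ε, hF, hε, hd, hdd⟩ := h
  refine ⟨fun i => Nat.casesOn i (ModuleCat.of S P) F,
    fun i => match i with
      | 0 => K.subtype ∘ₗ ε
      | i + 1 => d i, K.mkQ, ?_, K.mkQ_surjective, fun _ => ?_, ?_⟩
  · rintro (_ | i) hi
    · exact ⟨‹_›, ‹_›⟩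
    · exact hF i (Nat.le_of_succ_le_succ hi)
  · intro x
    change K.mkQ x = 0 ↔ x ∈ Set.range (K.subtype ∘ₗ ε)
    rw [Submodule.mkQ_apply, Submodule.Quotient.mk_eq_zero]
    constructor
    · intro hx
      obtain ⟨y, hy⟩ := hε ⟨x, hx⟩
      exact ⟨y, congrArg Subtype.val hy⟩
    · rintro ⟨y, rfl⟩
      exact (ε y).2
  · rintro (_ | i) hi
    · intro x
      change ((ε x : K) : P) = 0 ↔ _
      rw [Submodule.coe_eq_zero]
      exact hd (by omega) x
    · exact hdd i (by omega)

end FinitelyPresented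

/-! ### `Tor₁` as the kernel of `K ⊗ M → P ⊗ M` -/

section Tor

variable {R : Type u} [Ring R]

/-- Injectivity of `ker ε ⊗ M → P ⊗ M` does not depend on the choice of the epimorphism `ε` from
a projective module `P` onto a given module. -/
theorem BalancedTensor.map_ker_subtype_injective {X P Q : Type u} [AddCommGroup X] [Module Rᵐᵒᵖ X]
    [AddCommGroup P] [Module Rᵐᵒᵖ P] [AddCommGroup Q] [Module Rᵐᵒᵖ Q]
    [Module.Projective Rᵐᵒᵖ P] [Module.Projective Rᵐᵒᵖ Q] {M : Type u} [AddCommGroup M]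
    [Module R M] {ε : P →ₗ[Rᵐᵒᵖ] X} (hε : Function.Surjective ε) {η : Q →ₗ[Rᵐᵒᵖ] X}
    (hη : Function.Surjective η) (h : Function.Injective (map M (LinearMap.ker ε).subtype)) :
    Function.Injective (map M (LinearMap.ker η).subtype) := by
  obtain ⟨a, ha⟩ := Module.projective_lifting_property ε η hε
  obtain ⟨b, hb⟩ := Module.projective_lifting_property η ε hη
  have ha' (x : Q) : ε (a x) = η x := LinearMap.congr_fun ha x
  have hb' (x : P) : η (b x) = ε x := LinearMap.congr_fun hb x
  let a' : LinearMap.ker η →ₗ[Rᵐᵒᵖ] LinearMap.ker ε :=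
    a.restrict fun x (hx : η x = 0) => show ε (a x) = 0 by rw [ha', hx]
  let b' : LinearMap.ker ε →ₗ[Rᵐᵒᵖ] LinearMap.ker η :=
    b.restrict fun x (hx : ε x = 0) => show η (b x) = 0 by rw [hb', hx]
  -- The map `b ∘ a - id` lifts zero on `X`, so it lands in `ker η`: a chain homotopy. If `t` dies
  -- in `Q ⊗ M`, then `s ⊗ M` gives `b'a't = t`, while `a't = 0` by the injectivity for `ε`.
  let s : Q →ₗ[Rᵐᵒᵖ] LinearMap.ker η :=
    LinearMap.codRestrict _ (b ∘ₗ a - LinearMap.id) fun x => by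
      simp [ha', hb']
  have hs : s ∘ₗ (LinearMap.ker η).subtype = b' ∘ₗ a' - LinearMap.id := by
    ext x
    rfl
  refine (injective_iff_map_eq_zero _).2 fun t ht => ?_
  have hat : map M a' t = 0 := h (by
    rw [map_map, show (LinearMap.ker ε).subtype ∘ₗ a' = a ∘ₗ (LinearMap.ker η).subtype from rfl,
      ← map_map, ht, _root_.map_zero, _root_.map_zero])
  have := map_map (LinearMap.ker η).subtype s t
  rw [ht, _root_.map_zero, hs, map_sub_apply, map_id, ← map_map, hat, _root_.map_zero,
    zero_sub, eq_comm, neg_eq_zero] at this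
  exact this

/-- Factor `g` as a surjection `g'` onto `ker ε` followed by the inclusion. By right exactness the
image of `f ⊗ M` is the kernel of `g' ⊗ M`, so exactness means that the inclusion adds nothing to
this kernel. -/
theorem BalancedTensor.exact_map_iff_injective {P₂ P₁ P₀ X : Type u} [AddCommGroup P₂]
    [Module Rᵐᵒᵖ P₂] [AddCommGroup P₁] [Module Rᵐᵒᵖ P₁] [AddCommGroup P₀] [Module Rᵐᵒᵖ P₀]
    [AddCommGroup X] [Module Rᵐᵒᵖ X] {M : Type u} [AddCommGroup M] [Module R M]
    {f : P₂ →ₗ[Rᵐᵒᵖ] P₁} {g : P₁ →ₗ[Rᵐᵒᵖ] P₀} {ε : P₀ →ₗ[Rᵐᵒᵖ] X}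
    (hfg : Function.Exact f g) (hg : Function.Exact g ε) :
    Function.Exact (map M f) (map M g) ↔
      Function.Injective (map M (LinearMap.ker ε).subtype) := by
  obtain ⟨g', rfl⟩ : ∃ g' : P₁ →ₗ[Rᵐᵒᵖ] LinearMap.ker ε, g = (LinearMap.ker ε).subtype ∘ₗ g' :=
    ⟨g.codRestrict _ fun x => hg.apply_apply_eq_zero x, rfl⟩
  have hg' : Function.Surjective g' := by
    rintro ⟨x, hx⟩
    obtain ⟨y, hy⟩ := (hg x).1 hx
    exact ⟨y, Subtype.ext hy⟩
  have hfg' : Function.Exact f g' := fun x => by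
    rw [← hfg x, LinearMap.comp_apply, Submodule.subtype_apply, Submodule.coe_eq_zero]
  have hex : Function.Exact (map M f) (map M g') := map_exact hfg' hg'
  constructor
  · intro h
    refine (injective_iff_map_eq_zero _).2 fun t ht => ?_
    obtain ⟨t, rfl⟩ := map_surjective hg' t
    rw [map_map] at ht
    exact (hex t).2 ((h t).1 ht)
  · intro h t
    rw [← hex t, ← map_map]
    exact map_eq_zero_iff _ h

theorem isZero_torFunctor_one_iff (M : ModuleCat.{u} R) (X : ModuleCat.{u} Rᵐᵒᵖ) {P : Type u}
    [AddCommGroup P] [Module Rᵐᵒᵖ P] [Module.Projective Rᵐᵒᵖ P] {ε : P →ₗ[Rᵐᵒᵖ] X}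
    (hε : Function.Surjective ε) :
    IsZero ((torFunctor 1 M).obj X) ↔
      Function.Injective (BalancedTensor.map M (LinearMap.ker ε).subtype) := by
  let Q := projectiveResolution X
  rw [show torFunctor 1 M = (tensorFunctor M).leftDerived 1 from rfl,
    (Q.isoLeftDerivedObj (tensorFunctor M) 1).isZero_iff]
  change IsZero ((((tensorFunctor M).mapHomologicalComplex _).obj Q.complex).homology 1) ↔ _
  rw [← HomologicalComplex.exactAt_iff_isZero_homology,
    HomologicalComplex.exactAt_iff' _ 2 1 0 (by simp) (by simp), ShortComplex.ab_exact_iff_function_exact]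
  have h₁ : Function.Exact (Q.complex.d 2 1).hom (Q.complex.d 1 0).hom :=
    (ShortComplex.ShortExact.moduleCat_exact_iff_function_exact _).1 (Q.exact_succ 0)
  have h₀ : Function.Exact (Q.complex.d 1 0).hom (Q.π.f 0).hom :=
    (ShortComplex.ShortExact.moduleCat_exact_iff_function_exact _).1 Q.exact₀
  have hπ : Function.Surjective (Q.π.f 0).hom := (ModuleCat.epi_iff_surjective _).1 inferInstance
  have : Module.Projective Rᵐᵒᵖ (Q.complex.X 0) :=
    (IsProjective.iff_projective _).2 (Q.projective 0)
  refine (BalancedTensor.exact_map_iff_injective (M := M) h₁ h₀).trans ⟨fun h => ?_, fun h => ?_⟩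
  · exact BalancedTensor.map_ker_subtype_injective hπ hε h
  · exact BalancedTensor.map_ker_subtype_injective hε hπ h

theorem isFPFlat_succ_iff {n : ℕ} {M : ModuleCat.{u} R} :
    IsFPFlat (n + 1) M ↔ ∀ (P : Type u) [AddCommGroup P] [Module Rᵐᵒᵖ P] [Module.Finite Rᵐᵒᵖ P]
      [Module.Projective Rᵐᵒᵖ P] (K : Submodule Rᵐᵒᵖ P), IsFinitelyNPresented Rᵐᵒᵖ n K →
        Function.Injective (BalancedTensor.map M K.subtype) := by
  refine ⟨fun h P _ _ _ _ K hK => ?_, fun h X hX => ?_⟩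
  · have := (isZero_torFunctor_one_iff M (ModuleCat.of Rᵐᵒᵖ (P ⧸ K)) K.mkQ_surjective).1
      (h _ hK.quotient)
    rwa [Submodule.ker_mkQ] at this
  · obtain ⟨P, ε, _, _, hε, hK⟩ := hX.exists_ker
    exact (isZero_torFunctor_one_iff M X hε).2 (h P _ hK)

end Tor

/-! ### Flatness, products and projectivity of finitely presented modules -/

section Flatness

variable {R : Type u} [Ring R]

namespace BalancedTensor

variable {X : Type u} [AddCommGroup X] [Module Rᵐᵒᵖ X] {M N : Type u} [AddCommGroup M] [Module R M]
  [AddCommGroup N] [Module R N]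

/-- Finitely generated projective right modules are flat. -/
theorem mapRight_injective [Module.Finite Rᵐᵒᵖ X] [Module.Projective Rᵐᵒᵖ X] {g : M →ₗ[R] N}
    (hg : Function.Injective g) : Function.Injective (mapRight X g) := by
  obtain ⟨k, π, hπ⟩ := Module.Finite.exists_fin' Rᵐᵒᵖ X
  obtain ⟨s, hs⟩ := Module.projective_lifting_property π LinearMap.id hπ
  refine (injective_iff_map_eq_zero _).2 fun t ht => ?_
  -- `X` is a retract of `Rᵏ`, where the claim is injectivity of `g` in each coordinate.
  have hst : map M s t = 0 := by
    refine freeLeft_bijective.1 (funext fun i => hg ?_)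
    rw [← freeLeft_mapRight, ← map_mapRight, ht]
    simp
  rw [← map_id t, ← hs, ← map_map, hst, _root_.map_zero]

/-- For a finitely presented right module `X`, the canonical map `X ⊗ ∏ Mᵢ → ∏ (X ⊗ Mᵢ)` is
injective. -/
theorem eq_zero_of_forall_mapRight_proj_eq_zero [Module.FinitePresentation Rᵐᵒᵖ X] {ι : Type u}
    {M : ι → Type u} [∀ i, AddCommGroup (M i)] [∀ i, Module R (M i)]
    {t : BalancedTensor R X (∀ i, M i)}
    (ht : ∀ i, mapRight X (LinearMap.proj (R := R) (φ := M) i) t = 0) : t = 0 := by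
  obtain ⟨k, π, hπ⟩ := Module.Finite.exists_fin' Rᵐᵒᵖ X
  have hfin : Module.Finite Rᵐᵒᵖ (LinearMap.ker π) :=
    Module.Finite.iff_fg.2 (Module.FinitePresentation.fg_ker π hπ)
  obtain ⟨l, ρ, hρ⟩ := Module.Finite.exists_fin' Rᵐᵒᵖ (LinearMap.ker π)
  have hex : Function.Exact ((LinearMap.ker π).subtype ∘ₗ ρ) π := by
    rw [LinearMap.exact_iff, LinearMap.range_comp, LinearMap.range_eq_top.2 hρ,
      Submodule.map_top, Submodule.range_subtype]
  obtain ⟨t, rfl⟩ := map_surjective hπ t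
  have hi (i : ι) : ∃ u, map (M i) ((LinearMap.ker π).subtype ∘ₗ ρ) u =
      mapRight _ (LinearMap.proj (R := R) (φ := M) i) t :=
    (map_exact hex hπ _).1 (by rw [map_mapRight, ht])
  choose u hu using hi
  -- The separate preimages `u i` assemble into one, because `Rˡ ⊗ ∏ Mᵢ` is `(∏ Mᵢ)ˡ`.
  obtain ⟨v, hv⟩ := (freeLeft_bijective (R := R) (M := ∀ i, M i)).2 fun j i => freeLeft (Fin l) (M i) (u i) j
  refine (map_exact hex hπ t).2 ⟨v, freeLeft_bijective.1 (funext fun j => funext fun i => ?_)⟩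
  have hvu : mapRight _ (LinearMap.proj (R := R) (φ := M) i) v = u i :=
    freeLeft_bijective.1 (funext fun j => by rw [freeLeft_mapRight, hv]; rfl)
  have := congrFun (congrArg (freeLeft (Fin k) (M i)) (hu i)) j
  rw [← hvu, map_mapRight, freeLeft_mapRight, freeLeft_mapRight] at this
  exact this

/-- A finitely presented right module `X` is projective if `X ⊗ -` preserves the injectivity of
the inclusions of submodules of finitely generated free left modules. -/
theorem projective_of_mapRight_subtype_injective [Module.FinitePresentation Rᵐᵒᵖ X]
    (h : ∀ (m : ℕ) (N : Submodule R (Fin m → R)), Function.Injective (mapRight X N.subtype)) :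
    Module.Projective Rᵐᵒᵖ X := by
  obtain ⟨k, π, hπ⟩ := Module.Finite.exists_fin' Rᵐᵒᵖ X
  have hfin : Module.Finite Rᵐᵒᵖ (LinearMap.ker π) :=
    Module.Finite.iff_fg.2 (Module.FinitePresentation.fg_ker π hπ)
  obtain ⟨l, ρ, hρ⟩ := Module.Finite.exists_fin' Rᵐᵒᵖ (LinearMap.ker π)
  -- Equational criterion: with generators `x j` and relation matrix `a`, the aim is to write `x j =
  -- ∑ y p · b p j` with every row `b p` killed by `a`. This factors the identity of `X` through a
  -- free module.
  let x (j : Fin k) : X := π (Pi.single j 1)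
  let a (i : Fin l) (j : Fin k) : R := ((ρ (Pi.single i 1)).1 j).unop
  have hπx (v : Fin k → Rᵐᵒᵖ) : π v = ∑ j, v j • x j := by
    conv_lhs => rw [pi_eq_sum_univ' v]
    simp [x, Pi.single]
  have hxa (i : Fin l) : ∑ j, MulOpposite.op (a i j) • x j = 0 :=
    (hπx _).symm.trans (ρ (Pi.single i 1)).2
  let A : (Fin k → R) →ₗ[R] (Fin l → R) :=
    LinearMap.pi fun i => ∑ j, (LinearMap.toSpanSingleton R R (a i j)) ∘ₗ LinearMap.proj j
  have hA (b : Fin k → R) (i : Fin l) : A b i = ∑ j, b j * a i j := by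
    simp [A]
  -- In `X ⊗ Rˡ` the image of `∑ x j ⊗ e j` has the relations among the `x j` as coordinates, hence
  -- vanishes. Injectivity on `range A` puts the element in the image of `X ⊗ ker A`, which supplies
  -- `y` and `b`.
  have ht : mapRight X A.rangeRestrict (∑ j, tmul (x j) (Pi.single j 1)) = 0 := by
    refine h _ _ (freeRight_injective (funext fun i => ?_))
    rw [_root_.map_zero, mapRight_mapRight, map_sum, map_sum, Finset.sum_apply]
    have hAr : A.range.subtype ∘ₗ A.rangeRestrict = A := rfl
    simpa [hAr, hA, Pi.single_apply] using hxa i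
  obtain ⟨s, hs⟩ := exists_mapRight_eq_of_mapRight_eq_zero (f := (LinearMap.ker A).subtype)
    (by rw [LinearMap.exact_iff, LinearMap.ker_rangeRestrict, Submodule.range_subtype])
    A.surjective_rangeRestrict ht
  obtain ⟨q, y, b, rfl⟩ := exists_sum_tmul s
  have hyb (j : Fin k) : ∑ p, MulOpposite.op ((b p).1 j) • y p = x j := by
    have := congrFun (congrArg (freeRight X (Fin k)) hs) j
    simpa [Pi.single_apply, apply_ite, ite_smul] using this
  let B : (Fin k → Rᵐᵒᵖ) →ₗ[Rᵐᵒᵖ] (Fin q → Rᵐᵒᵖ) :=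
    LinearMap.pi fun p => ∑ j,
      (LinearMap.toSpanSingleton Rᵐᵒᵖ Rᵐᵒᵖ (MulOpposite.op ((b p).1 j))) ∘ₗ LinearMap.proj j
  have hB (v : Fin k → Rᵐᵒᵖ) (p : Fin q) :
      B v p = ∑ j, v j * MulOpposite.op ((b p).1 j) := by
    simp [B]
  have hBρ : B ∘ₗ (LinearMap.ker π).subtype ∘ₗ ρ = 0 := by
    refine LinearMap.pi_ext' fun i => LinearMap.ext_ring (funext fun p => ?_)
    have : ∑ j, (b p).1 j * a i j = 0 := by
      rw [← hA]; exact congrFun (b p).2 i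
    have := congrArg MulOpposite.op this
    simpa [hB, a] using this
  -- So `B` descends to `X ≅ Rᵏ/ker π`, and `g ∘ B = π` makes `g` a retraction of the descended map.
  have hBπ : LinearMap.ker π ≤ LinearMap.ker B := fun v hv => by
    obtain ⟨w, hw⟩ := hρ ⟨v, hv⟩
    have := LinearMap.congr_fun hBρ w
    simpa [hw] using this
  let g : (Fin q → Rᵐᵒᵖ) →ₗ[Rᵐᵒᵖ] X := Fintype.linearCombination Rᵐᵒᵖ y
  have hgB : g ∘ₗ B = π := by
    refine LinearMap.pi_ext' fun j => LinearMap.ext_ring ?_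
    simpa [g, hB, Fintype.linearCombination_apply, Pi.single_apply] using hyb j
  let e := π.quotKerEquivOfSurjective hπ
  refine Module.Projective.of_split ((LinearMap.ker π).liftQ B hBπ ∘ₗ e.symm.toLinearMap) g ?_
  ext z
  obtain ⟨v, rfl⟩ := hπ z
  have : e.symm (π v) = Submodule.Quotient.mk v := by
    rw [LinearEquiv.symm_apply_eq]; rfl
  simpa [this] using LinearMap.congr_fun hgB v

end BalancedTensor

end Flatness

/-! ### The implications -/

section Main

variable {R : Type u} [Ring R] {n : ℕ}

open BalancedTensor

theorem IsFPFlat.of_linearEquiv {M N : ModuleCat.{u} R} (h : IsFPFlat (n + 1) M)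
    (e : M ≃ₗ[R] N) : IsFPFlat (n + 1) N := by
  rw [isFPFlat_succ_iff] at h ⊢
  refine fun P _ _ _ _ K hK => (injective_iff_map_eq_zero _).2 fun t ht => ?_
  have h0 : mapRight K e.symm.toLinearMap t = 0 := h P K hK (by
    rw [map_mapRight, ht, _root_.map_zero, _root_.map_zero])
  have := mapRight_mapRight e.symm.toLinearMap e.toLinearMap t
  rwa [h0, _root_.map_zero, LinearEquiv.comp_coe, LinearEquiv.symm_trans_self,
    LinearEquiv.refl_toLinearMap, mapRight_id, eq_comm] at this

theorem isFPFlat_of_injective (hsub : IsClosedUnderSubmodules (IsFPFlat (R := R) (n + 1)))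
    {M N : ModuleCat.{u} R} (hM : IsFPFlat (n + 1) M) {f : N →ₗ[R] M}
    (hf : Function.Injective f) : IsFPFlat (n + 1) N :=
  (hsub M hM (LinearMap.range f)).of_linearEquiv (LinearEquiv.ofInjective f hf).symm

/-- Direct products of `FP_n`-flat modules are `FP_n`-flat if `n ≥ 2`. -/
theorem isFPFlat_isClosedUnderDirectProducts :
    IsClosedUnderDirectProducts (IsFPFlat (R := R) (n + 2)) := by
  intro ι M hM
  rw [isFPFlat_succ_iff]
  refine fun P _ _ _ _ K hK => (injective_iff_map_eq_zero _).2 fun t ht => ?_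
  have := hK.finitePresentation
  refine eq_zero_of_forall_mapRight_proj_eq_zero fun i => ?_
  refine isFPFlat_succ_iff.1 (hM i) P K hK ?_
  rw [map_mapRight, _root_.map_zero]
  exact (congrArg _ ht).trans (_root_.map_zero _)

/-- Here `K` is projective, so `K ⊗ N → K ⊗ M → P ⊗ M` is a composite of injections, and it factors
through `K ⊗ N → P ⊗ N`. -/
theorem isClosedUnderSubmodules_of_isRightNHereditary (h : IsRightNHereditary R (n + 2)) :
    IsClosedUnderSubmodules (IsFPFlat (R := R) (n + 2)) := by
  intro M hM N
  rw [isFPFlat_succ_iff] at hM ⊢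
  refine fun P _ _ _ _ K hK => (injective_iff_map_eq_zero _).2 fun t ht => ?_
  have := hK.finitePresentation
  have := h P inferInstance inferInstance K hK
  have hinj : Function.Injective (mapRight K N.subtype) :=
    mapRight_injective N.subtype_injective
  refine hinj (hM P K hK ?_)
  rw [map_mapRight, _root_.map_zero, _root_.map_zero]
  exact (congrArg _ ht).trans (_root_.map_zero _)

/-- In coordinates, `K ⊗ Rᵐ → P ⊗ Rᵐ` is the inclusion `Kᵐ ⊆ Pᵐ`. -/
theorem isFPFlat_free (m : ℕ) : IsFPFlat (n + 1) (ModuleCat.of R (Fin m → R)) := by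
  rw [isFPFlat_succ_iff]
  refine fun P _ _ _ _ K hK => (injective_iff_map_eq_zero _).2 fun t ht => ?_
  refine freeRight_injective (funext fun i => Subtype.ext ?_)
  have := freeRight_map K.subtype t i
  rw [Submodule.subtype_apply] at this
  rw [← this]
  exact (congrFun (congrArg (freeRight P (Fin m)) ht) i).trans (by simp)

theorem isRightNHereditary_of_isClosedUnderSubmodules
    (h : IsClosedUnderSubmodules (IsFPFlat (R := R) (n + 2))) :
    IsRightNHereditary R (n + 2) := by
  intro P _ _ _ _ K hK
  -- The index `n + 2 - 1` reduces to `n + 1 ≥ 1`, so `K` is finitely presented; this needs the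
  -- original index to exceed 1.
  have := IsFinitelyNPresented.finitePresentation (n := n) hK
  refine projective_of_mapRight_subtype_injective fun m N =>
    (injective_iff_map_eq_zero _).2 fun t ht => ?_
  refine isFPFlat_succ_iff.1 (h _ (isFPFlat_free m) N) P K hK ?_
  have hP : Function.Injective (mapRight P N.subtype) := mapRight_injective N.subtype_injective
  refine hP ?_
  rw [_root_.map_zero, _root_.map_zero]
  exact (map_mapRight _ _ t).symm.trans ((congrArg _ ht).trans (_root_.map_zero _))

/-- If the `FP_n`-flat modules form a pretorsion-free class, then the quotient of `M` by its
smallest submodule with `FP_n`-flat quotient is an epimorphic `FP_n`-flat envelope of `M`. -/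
theorem hasEpimorphicEnvelope (hsub : IsClosedUnderSubmodules (IsFPFlat (R := R) (n + 1)))
    (hprod : IsClosedUnderDirectProducts (IsFPFlat (R := R) (n + 1))) (M : ModuleCat.{u} R) :
    HasEpimorphicEnvelope (IsFPFlat (R := R) (n + 1)) M := by
  let ι := {N : Submodule R M // IsFPFlat (n + 1) (ModuleCat.of R (M ⧸ N))}
  let Φ : M →ₗ[R] (∀ N : ι, M ⧸ N.1) := LinearMap.pi fun N => N.1.mkQ
  have hE : IsFPFlat (n + 1) (ModuleCat.of R (LinearMap.range Φ)) :=
    hsub _ (hprod ι (fun N => ModuleCat.of R (M ⧸ N.1)) fun N => N.2) _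
  refine ⟨ModuleCat.of R (LinearMap.range Φ), Φ.rangeRestrict, ⟨⟨hE, fun E' hE' f => ?_⟩,
    fun g hg => ?_⟩, Φ.surjective_rangeRestrict⟩
  -- `M/ker f` embeds in `E'`, so `ker f` is one of the indices in `ι` and `f` factors through that
  -- coordinate of `Φ`.
  · have hf : IsFPFlat (n + 1) (ModuleCat.of R (M ⧸ LinearMap.ker f)) :=
      isFPFlat_of_injective hsub hE' (f := (LinearMap.ker f).liftQ f le_rfl)
        (LinearMap.ker_eq_bot.1 (Submodule.ker_liftQ_eq_bot _ _ _ le_rfl))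
    refine ⟨(LinearMap.ker f).liftQ f le_rfl ∘ₗ
      LinearMap.proj (R := R) (φ := fun N : ι => M ⧸ N.1) ⟨LinearMap.ker f, hf⟩ ∘ₗ
      (LinearMap.range Φ).subtype, ?_⟩
    ext x
    rfl
  · have : g = LinearMap.id := by
      refine LinearMap.ext fun y => ?_
      obtain ⟨x, rfl⟩ := Φ.surjective_rangeRestrict y
      exact LinearMap.congr_fun hg x
    rw [this]
    exact Function.bijective_id

/-- The inclusion `N ⊆ M` factors through the envelope of `N`, which is therefore injective as well
as surjective, so `N` is isomorphic to an `FP_n`-flat module. -/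
theorem isClosedUnderSubmodules_of_hasEpimorphicEnvelope
    (h : ∀ M : ModuleCat.{u} R, HasEpimorphicEnvelope (IsFPFlat (R := R) (n + 1)) M) :
    IsClosedUnderSubmodules (IsFPFlat (R := R) (n + 1)) := by
  intro M hM N
  obtain ⟨E, φ, ⟨⟨hE, hφ⟩, -⟩, hsurj⟩ := h (ModuleCat.of R N)
  obtain ⟨g, hg⟩ := hφ M hM N.subtype
  have hinj : Function.Injective φ := by
    refine Function.Injective.of_comp (f := g) ?_
    rw [← LinearMap.coe_comp, hg]
    exact N.subtype_injective
  exact hE.of_linearEquiv (LinearEquiv.ofBijective φ ⟨hinj, hsurj⟩).symm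

end Main

theorem proposition3p8 (R : Type u) [Ring R] (n : ℕ) (hn : 1 < n) :
    [(∀ M : ModuleCat.{u} R, HasEpimorphicEnvelope (IsFPFlat (R := R) n) M),
      IsRightNHereditary R n,
      IsClosedUnderSubmodules (IsFPFlat (R := R) n),
      IsPretorsionFreeClass (IsFPFlat (R := R) n)].TFAE := by
  obtain ⟨n, rfl⟩ := Nat.exists_eq_add_of_le' hn
  tfae_have 1 → 3 := isClosedUnderSubmodules_of_hasEpimorphicEnvelope
  tfae_have 2 → 3 := isClosedUnderSubmodules_of_isRightNHereditary
  tfae_have 3 → 2 := isRightNHereditary_of_isClosedUnderSubmodules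
  tfae_have 3 → 4 := fun h => ⟨h, isFPFlat_isClosedUnderDirectProducts⟩
  tfae_have 4 → 1 := fun h => hasEpimorphicEnvelope h.1 h.2
  tfae_finish
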